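/- Let $\mathbb K$ be an algebraically closed field. By an algebraic prevariety over $\mathbb K$ we mean a not necessarily separated and not necessarily irreducible variety, i.e. the set of closed points, with its Zariski topology, of a reduced (not necessarily separated) scheme of finite type over $\mathbb K$; morphisms are the maps of closed points induced by morphisms of schemes over $\mathbb K$. An irreducible curve in a prevariety is an irreducible closed subset of dimension $1$. A morphism $p\colon X\to Y$ of prevarieties satisfies the curve covering property if for every irreducible curve $Y'\subset Y$ and every $y\in Y'$ there is an irreducible curve $X'\subset X$ such that $y\in p(X')\subset Y'$ and $p(X')$ is dense in $Y'$. Let $p\colon X\to Y$ be a surjective morphism of algebraic prevarieties over $\mathbb K$. Then $p$ satisfies the curve covering property if and only if $p$ is submersive, i.e. $Y$ carries the quotient topology with respect to $p$ (a subset $U\subset Y$ is open if and only if $p^{-1}(U)$ is open in $X$). -/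

import Mathlib

open CategoryTheory AlgebraicGeometry Topology

universe u

/-- An algebraic prevariety over the field `K` (to be used with `K` algebraically closed): a reduced
scheme of finite type over `K`. It is neither required to be separated nor to be irreducible.
As everywhere in classical algebraic geometry, its *points* are the closed points
of this scheme, see `AlgebraicPrevariety.Point`. -/
structure AlgebraicPrevariety (K : Type u) [Field K] where
  /-- the underlying scheme -/
  scheme : Scheme.{u}
  /-- the structure morphism to `Spec K` -/
  str : scheme ⟶ Spec (.of K)
  isReduced : IsReduced scheme
  locallyOfFiniteType : LocallyOfFiniteType str
  quasiCompact : QuasiCompact str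

namespace AlgebraicPrevariety

variable {K : Type u} [Field K]

attribute [instance] isReduced locallyOfFiniteType quasiCompact

/-- The points of a prevariety in the classical sense: the closed points of the underlying scheme
(for algebraically closed `K` these are the `K`-rational points, see
`AlgebraicGeometry.pointEquivClosedPoint`). They carry the Zariski topology, that is, the subspace
topology. -/
abbrev Point (X : AlgebraicPrevariety K) : Type u :=
  closedPoints X.scheme

/-- A morphism of prevarieties over `K`. -/
structure Hom (X Y : AlgebraicPrevariety K) where
  /-- the underlying morphism of schemes -/
  hom : X.scheme ⟶ Y.scheme
  w : hom ≫ Y.str = X.str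

theorem Hom.isClosed_singleton {X Y : AlgebraicPrevariety K} (p : X.Hom Y) (x : X.Point) :
    IsClosed ({p.hom x.1} : Set Y.scheme) := by
  have h : LocallyOfFiniteType (p.hom ≫ Y.str) := by
    rw [p.w]; infer_instance
  have hp : LocallyOfFiniteType p.hom := locallyOfFiniteType_of_comp p.hom Y.str
  have hY : JacobsonSpace Y.scheme := LocallyOfFiniteType.jacobsonSpace Y.str
  exact p.hom.closePoints_subset_preimage_closedPoints x.2

/-- The map on points induced by a morphism of prevarieties. -/
def Hom.onPoints {X Y : AlgebraicPrevariety K} (p : X.Hom Y) (x : X.Point) : Y.Point :=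
  ⟨p.hom x.1, p.isClosed_singleton x⟩

/-- An irreducible curve in a prevariety: an irreducible closed set of points, of dimension `1`. -/
structure IsIrreducibleCurve {X : AlgebraicPrevariety K} (C : Set X.Point) : Prop where
  isClosed : IsClosed C
  isIrreducible : IsIrreducible C
  dim_eq_one : topologicalKrullDim C = 1

/-- The curve covering property (CCP): for every irreducible curve `Y'` in `Y` and every `y ∈ Y'`
there is an irreducible curve `X'` in `X` such that `y ∈ p(X') ⊆ Y'` and `p(X')` is dense in
`Y'`. -/
def Hom.CurveCoveringProperty {X Y : AlgebraicPrevariety K} (p : X.Hom Y) : Prop :=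
  ∀ Y' : Set Y.Point, IsIrreducibleCurve Y' → ∀ y ∈ Y',
    ∃ X' : Set X.Point, IsIrreducibleCurve X' ∧
      y ∈ p.onPoints '' X' ∧ p.onPoints '' X' ⊆ Y' ∧ Y' ⊆ closure (p.onPoints '' X')

/-- `p : X → Y` is submersive: it is surjective and `Y` carries the quotient topology with respect
to `p`. -/
def Hom.IsSubmersive {X Y : AlgebraicPrevariety K} (p : X.Hom Y) : Prop :=
  IsQuotientMap p.onPoints

end AlgebraicPrevariety

/-! Irreducible curves are the closed points of closures of curve points (`isIrreducibleCurve_iff`),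
so everything reduces to specializations of scheme points. The key tool is `exists_isCurvePoint`: if
`v` lies in an open `U` and specializes to a closed point `x` outside `U`, some curve through `x` in
the closure of `v` has its generic point in `U`.

CCP implies submersive: let `Z` have closed preimage, cut out by a closed `F`. By Chevalley `p(F)`
is constructible. If `y` lies in the closure of `Z` but not in `Z`, then `y` specializes some `p(v)`
with `v ∈ F`, and `p(F)` contains a neighbourhood of `p(v)` in its closure. Lift a curve through `y`
meeting this neighbourhood: the lift lies in `F` generically, hence entirely, so `y ∈ Z`.

Submersive implies CCP: remove the fibre over `y` from the preimage of `Y'`. If no point of that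
fibre were in the closure of the rest, `Y' \ {y}` would be closed, against irreducibility. So a
curve in the preimage meets the fibre without lying in it, and it dominates `Y'`. -/

/-! ### Heights in finitely generated algebras -/

theorem MvPolynomial.height_eq_of_isMaximal {k : Type*} [Field k] (n : ℕ)
    (m : Ideal (MvPolynomial (Fin n) k)) [hm : m.IsMaximal] : m.height = n := by
  induction n with
  | zero =>
    have : ringKrullDim (MvPolynomial (Fin 0) k) = 0 := by simp
    have h := Ideal.height_le_ringKrullDim_of_ne_top hm.ne_top
    rw [this] at h
    simpa using h
  | succ n ih =>
    let e := MvPolynomial.finSuccEquiv k n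
    let M := m.comap e.symm.toRingEquiv
    have hM : M.IsMaximal := Ideal.comap_isMaximal_of_surjective _ e.symm.surjective
    have hmM : M.height = m.height := RingEquiv.height_comap e.symm.toRingEquiv m
    let : Algebra (MvPolynomial (Fin n) k) (Polynomial (MvPolynomial (Fin n) k)) :=
      Polynomial.algebraOfAlgebra
    -- Nullstellensatz: polynomial rings over a field are Jacobson.
    have hc : (M.under (MvPolynomial (Fin n) k)).IsMaximal :=
      Polynomial.isMaximal_comap_C_of_isJacobsonRing M
    have : M.LiesOver (M.under (MvPolynomial (Fin n) k)) := ⟨rfl⟩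
    rw [← hmM, Polynomial.height_eq_height_add_one (M.under (MvPolynomial (Fin n) k)) M, ih]
    simp

/-- Noether normalization: going down bounds the number of variables by the height of `m`, so one
maximal ideal of height at most one forces dimension at most one everywhere. -/
theorem Ideal.IsPrime.isMaximal_of_height_le_one (k : Type*) {R : Type*} [Field k] [CommRing R]
    [Algebra k R] [Algebra.FiniteType k R] [IsDomain R] (m : Ideal R) [m.IsMaximal]
    (hm : m.height ≤ 1) (p : Ideal R) (hp : p.IsPrime) (hp0 : p ≠ ⊥) : p.IsMaximal := by
  obtain ⟨n, g, hg, hgi⟩ := exists_integral_inj_algHom_of_fg k R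
  algebraize [g.toRingHom]
  have : FaithfulSMul (MvPolynomial (Fin n) k) R :=
    (faithfulSMul_iff_algebraMap_injective _ _).mpr hg
  have : IsNoetherianRing R := Algebra.FiniteType.isNoetherianRing k R
  have hmax : (m.under (MvPolynomial (Fin n) k)).IsMaximal :=
    Ideal.isMaximal_comap_of_isIntegral_of_isMaximal m
  have h := Ideal.height_eq_height_add_of_liesOver_of_hasGoingDown
    (m.under (MvPolynomial (Fin n) k)) m
  rw [MvPolynomial.height_eq_of_isMaximal] at h
  have hn : n ≤ 1 := by
    have : (n : ℕ∞) ≤ 1 := (le_self_add.trans h.ge).trans hm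
    exact_mod_cast this
  have hdim : Ring.KrullDimLE 1 (MvPolynomial (Fin n) k) := by
    rw [Ring.krullDimLE_iff, MvPolynomial.ringKrullDim_of_isNoetherianRing,
      ringKrullDim_eq_zero_of_field]
    simpa using hn
  have hq : p.under (MvPolynomial (Fin n) k) ≠ ⊥ := by
    obtain ⟨x, hx, hx0⟩ := Submodule.exists_mem_ne_zero_of_ne_bot hp0
    exact Ideal.comap_ne_bot_of_integral_mem hx0 hx (Algebra.IsIntegral.isIntegral x)
  have : (p.under (MvPolynomial (Fin n) k)).IsMaximal :=
    Ideal.IsPrime.isMaximal_of_ne_bot inferInstance hq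
  exact Ideal.isMaximal_of_isIntegral_of_isMaximal_comap p this

/-- In a finitely generated algebra over a field, if no prime lies strictly between the prime `q`
and some maximal ideal above it, then all the primes strictly above `q` are maximal. -/
theorem Ideal.isMaximal_of_lt_of_forall_between (k : Type*) {R : Type*} [Field k] [CommRing R]
    [Algebra k R] [Algebra.FiniteType k R] (q m : Ideal R) [q.IsPrime] [hm : m.IsMaximal]
    (hqm : q ≤ m) (h : ∀ p : Ideal R, p.IsPrime → q ≤ p → p ≤ m → p = q ∨ p = m)
    (p : Ideal R) (hp : p.IsPrime) (hqp : q < p) : p.IsMaximal := by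
  have hk : RingHom.ker (Ideal.Quotient.mk q) ≤ m := by rwa [Ideal.mk_ker]
  have hkp : RingHom.ker (Ideal.Quotient.mk q) ≤ p := by rw [Ideal.mk_ker]; exact hqp.le
  have hM : (m.map (Ideal.Quotient.mk q)).IsMaximal :=
    (Ideal.map_eq_top_or_isMaximal_of_surjective _ Ideal.Quotient.mk_surjective hm).resolve_left
      fun h0 ↦ hm.ne_top (by
        rw [← sup_eq_left.mpr hk, ← Ideal.comap_map_of_surjective' _ Ideal.Quotient.mk_surjective,
          h0, Ideal.comap_top])
  have hht : (m.map (Ideal.Quotient.mk q)).height ≤ 1 := by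
    rw [← Nat.cast_one, Ideal.height_le_iff]
    intro P hP hPm
    have hP0 : P = ⊥ := by
      have hc : P.comap (Ideal.Quotient.mk q) ≤ m := by
        have := Ideal.comap_mono (f := Ideal.Quotient.mk q) hPm.le
        rwa [Ideal.comap_map_of_surjective' _ Ideal.Quotient.mk_surjective,
          sup_eq_left.mpr hk] at this
      have hqc : q ≤ P.comap (Ideal.Quotient.mk q) := by
        exact Ideal.mk_ker.ge.trans (Ideal.comap_mono bot_le)
      rw [← Ideal.map_comap_of_surjective _ Ideal.Quotient.mk_surjective P]
      rcases h _ (Ideal.IsPrime.comap _) hqc hc with h1 | h1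
      · rw [h1, Ideal.map_quotient_self]
      · exact absurd (by rw [← h1,
          Ideal.map_comap_of_surjective _ Ideal.Quotient.mk_surjective]) hPm.ne
    simp [hP0]
  have hpm : (p.map (Ideal.Quotient.mk q)).IsMaximal := by
    refine Ideal.IsPrime.isMaximal_of_height_le_one k _ hht _
      (Ideal.map_isPrime_of_surjective Ideal.Quotient.mk_surjective hkp) fun h0 ↦ ?_
    rw [Ideal.map_eq_bot_iff_le_ker, Ideal.mk_ker] at h0
    exact hqp.not_ge h0
  have := Ideal.comap_isMaximal_of_surjective (Ideal.Quotient.mk q)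
    Ideal.Quotient.mk_surjective (K := p.map (Ideal.Quotient.mk q))
  rwa [Ideal.comap_map_of_surjective' _ Ideal.Quotient.mk_surjective,
    sup_eq_left.mpr hkp] at this

/-! ### Chains of primes in Noetherian rings -/

section Between

variable {R : Type*} [CommRing R] [IsNoetherianRing R]

/-- Krull's principal ideal theorem in the domain `R ⧸ q`. -/
theorem Ideal.eq_of_lt_of_mem_minimalPrimes_sup_span_singleton {q r p : Ideal R} [q.IsPrime]
    [r.IsPrime] {x : R} (hp : p ∈ (q ⊔ Ideal.span {x}).minimalPrimes) (hqr : q ≤ r)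
    (hrp : r < p) : r = q := by
  have hkr : RingHom.ker (Ideal.Quotient.mk q) ≤ r := by rwa [Ideal.mk_ker]
  have hkp : RingHom.ker (Ideal.Quotient.mk q) ≤ p := hkr.trans hrp.le
  have hr := Ideal.map_isPrime_of_surjective Ideal.Quotient.mk_surjective hkr
  have := hp.1.1
  have hp' := Ideal.map_isPrime_of_surjective Ideal.Quotient.mk_surjective hkp
  have hlt : r.map (Ideal.Quotient.mk q) < p.map (Ideal.Quotient.mk q) := by
    refine (Ideal.map_mono hrp.le).lt_of_not_ge fun hle ↦ hrp.not_ge ?_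
    have := Ideal.comap_mono (f := Ideal.Quotient.mk q) hle
    rwa [Ideal.comap_map_of_surjective' _ Ideal.Quotient.mk_surjective,
      Ideal.comap_map_of_surjective' _ Ideal.Quotient.mk_surjective,
      sup_eq_left.mpr hkr, sup_eq_left.mpr hkp] at this
  have h := Ideal.height_le_iff.mp (Nat.cast_one (R := ℕ∞) ▸
    Ideal.map_height_le_one_of_mem_minimalPrimes hp) _ hr hlt
  rw [Nat.cast_one, Order.lt_one_iff, Ideal.height_eq_zero_iff] at h
  rw [IsDomain.minimalPrimes_eq_singleton_bot, Set.mem_singleton_iff,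
    Ideal.map_eq_bot_iff_le_ker, Ideal.mk_ker] at h
  exact h.antisymm hqr

/-- Primes not containing `f` and contained in a prime `m` containing `f` can be enlarged until
no prime lies strictly in between. -/
theorem Ideal.exists_isPrime_notMem_forall_between {q m : Ideal R} [hq : q.IsPrime]
    [hm : m.IsPrime] (hqm : q ≤ m) {f : R} (hfq : f ∉ q) :
    ∃ c : Ideal R, c.IsPrime ∧ f ∉ c ∧ q ≤ c ∧ c ≤ m ∧
      ∀ p : Ideal R, p.IsPrime → c ≤ p → p ≤ m → p = c ∨ p = m := by
  obtain ⟨c, ⟨hc, hfc, hqc, hcm⟩, hmax⟩ := wellFounded_gt.has_min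
    {c : Ideal R | c.IsPrime ∧ f ∉ c ∧ q ≤ c ∧ c ≤ m} ⟨q, hq, hfq, le_rfl, hqm⟩
  refine ⟨c, hc, hfc, hqc, hcm, fun p hp hcp hpm ↦ ?_⟩
  -- As `c` is maximal among the primes below `m` avoiding `f`, larger ones contain `f`.
  have key (r : Ideal R) (hr : r.IsPrime) (hcr : c < r) (hrm : r ≤ m) : f ∈ r := by
    by_contra hfr
    exact hmax r ⟨hr, hfr, hqc.trans hcr.le, hrm⟩ hcr
  by_contra! ⟨hpc, hpm'⟩
  have hfm : f ∈ m := hpm (key p hp (lt_of_le_of_ne hcp hpc.symm) hpm)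
  have hcf : c ⊔ Ideal.span {f} ≤ m := sup_le hcm (by simpa [Ideal.span_le] using hfm)
  have hfin := Ideal.finite_minimalPrimes_of_isNoetherianRing R (c ⊔ Ideal.span {f})
  -- Prime avoidance: by Krull, a prime strictly between `c` and `m` prevents `m` from being minimal
  -- over `c + (f)`. A minimal prime `r` over `c + (g)` will then contain `f` without being minimal
  -- over `c + (f)`, contradicting Krull.
  obtain ⟨g, hgm, hg⟩ : ∃ g ∈ m, ∀ p₀ ∈ (c ⊔ Ideal.span {f}).minimalPrimes, g ∉ p₀ := by
    by_contra! H
    obtain ⟨p₀, hp₀, hle⟩ := (Ideal.subset_union_prime_finite hfin (f := id) ⊥ ⊥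
      fun i hi _ _ ↦ hi.1.1).mp (fun g hg ↦ by
        obtain ⟨p₀, h₀, h₁⟩ := H g hg
        exact Set.mem_biUnion h₀ h₁)
    obtain rfl : m = p₀ := le_antisymm hle (hp₀.2 ⟨hm, hcf⟩ hle)
    exact hpc (Ideal.eq_of_lt_of_mem_minimalPrimes_sup_span_singleton hp₀ hcp
      (lt_of_le_of_ne hpm hpm'))
  obtain ⟨r, hr, hrm⟩ := Ideal.exists_minimalPrimes_le
    (sup_le hcm (by simpa [Ideal.span_le] using hgm) : c ⊔ Ideal.span {g} ≤ m)
  have hgr : g ∈ r := hr.1.2 (Ideal.mem_sup_right (Ideal.mem_span_singleton_self g))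
  have hcr : c ≤ r := le_sup_left.trans hr.1.2
  have := hr.1.1
  have hcr' : c < r := by
    refine lt_of_le_of_ne hcr fun h ↦ ?_
    obtain ⟨p₀, hp₀, -⟩ := Ideal.exists_minimalPrimes_le hcf
    exact hg p₀ hp₀ (hp₀.1.2 (Ideal.mem_sup_left (h ▸ hgr)))
  have hfr := key r this hcr' hrm
  obtain ⟨p₀, hp₀, hp₀r⟩ := Ideal.exists_minimalPrimes_le
    (sup_le hcr (by simpa [Ideal.span_le] using hfr) : c ⊔ Ideal.span {f} ≤ r)
  have := hp₀.1.1
  obtain h | rfl := hp₀r.lt_or_eq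
  · obtain rfl := Ideal.eq_of_lt_of_mem_minimalPrimes_sup_span_singleton hr
      (le_sup_left.trans hp₀.1.2) h
    exact hfc (hp₀.1.2 (Ideal.mem_sup_right (Ideal.mem_span_singleton_self f)))
  · exact hg _ hp₀ hgr

end Between

/-! ### Curves through a closed point -/

namespace AlgebraicGeometry

/-- The point `c` is not closed, and its proper specializations are closed points: in a Jacobson
space this says that the closure of `c` has dimension one. -/
def IsCurvePoint {X : Type*} [TopologicalSpace X] (c : X) : Prop :=
  ¬ IsClosed {c} ∧ ∀ z, c ⤳ z → z = c ∨ IsClosed {z}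

section Affine

variable {X : Type*} [TopologicalSpace X] {R : Type*} [CommRing R] {j : PrimeSpectrum R → X}

theorem exists_eq_and_le_of_specializes (hj : IsOpenEmbedding j) {a : X} {b : PrimeSpectrum R}
    (h : a ⤳ j b) : ∃ a', j a' = a ∧ a' ≤ b := by
  obtain ⟨a', rfl⟩ := h.mem_open hj.isOpen_range ⟨b, rfl⟩
  exact ⟨a', rfl, (PrimeSpectrum.le_iff_specializes _ _).mpr
    (hj.isInducing.specializes_iff.mp h)⟩

theorem isClosed_singleton_iff_isMaximal [JacobsonSpace X] (hj : IsOpenEmbedding j)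
    (a : PrimeSpectrum R) : IsClosed {j a} ↔ a.asIdeal.IsMaximal := by
  rw [← PrimeSpectrum.isClosed_singleton_iff_isMaximal]
  have := hj.preimage_closedPoints
  exact Set.ext_iff.mp this a

theorem exists_specializes_forall_between_of_affine [IsNoetherianRing R] (hj : IsOpenEmbedding j)
    {U : Set X} (hU : IsOpen U) {v x : X} (hx : x ∈ Set.range j) (hv : v ∈ U) (hvx : v ⤳ x) :
    ∃ c ∈ U, v ⤳ c ∧ c ⤳ x ∧ ∀ d, c ⤳ d → d ⤳ x → d = c ∨ d = x := by
  obtain ⟨x, rfl⟩ := hx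
  obtain ⟨v, rfl, hvx'⟩ := exists_eq_and_le_of_specializes hj hvx
  obtain ⟨_, ⟨f, rfl⟩, hvf, hfU⟩ :=
    PrimeSpectrum.isTopologicalBasis_basic_opens.exists_subset_of_mem_open
      (show v ∈ j ⁻¹' U from hv) (hU.preimage hj.continuous)
  obtain ⟨c, hc, hfc, hvc, hcx, H⟩ := Ideal.exists_isPrime_notMem_forall_between
    (show v.asIdeal ≤ x.asIdeal from hvx') hvf
  have spec {a b : PrimeSpectrum R} (h : a.asIdeal ≤ b.asIdeal) : j a ⤳ j b :=
    hj.isInducing.specializes_iff.mpr ((PrimeSpectrum.le_iff_specializes _ _).mp h)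
  refine ⟨j ⟨c, hc⟩, hfU hfc, spec hvc, spec hcx, fun d hcd hdx ↦ ?_⟩
  obtain ⟨d, rfl, hdx'⟩ := exists_eq_and_le_of_specializes hj hdx
  obtain ⟨c', h, hcd'⟩ := exists_eq_and_le_of_specializes hj hcd
  obtain rfl := hj.injective h
  exact (H d.asIdeal d.2 hcd' hdx').imp (fun h ↦ congrArg j (PrimeSpectrum.ext h))
    (fun h ↦ congrArg j (PrimeSpectrum.ext h))

theorem eq_or_isClosed_singleton_of_forall_between [JacobsonSpace X] (k : Type*) [Field k]
    [Algebra k R] [Algebra.FiniteType k R] (hj : IsOpenEmbedding j) {c x z : X}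
    (hx : IsClosed {x}) (hcx : c ⤳ x) (H : ∀ d, c ⤳ d → d ⤳ x → d = c ∨ d = x)
    (hxj : x ∈ Set.range j) (hzj : z ∈ Set.range j) (hcz : c ⤳ z) : z = c ∨ IsClosed {z} := by
  obtain ⟨x, rfl⟩ := hxj
  obtain ⟨z, rfl⟩ := hzj
  obtain ⟨c, rfl, hcx'⟩ := exists_eq_and_le_of_specializes hj hcx
  obtain ⟨c', h, hcz'⟩ := exists_eq_and_le_of_specializes hj hcz
  obtain rfl := hj.injective h
  rw [isClosed_singleton_iff_isMaximal hj] at hx ⊢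
  have spec {a b : PrimeSpectrum R} (h : a.asIdeal ≤ b.asIdeal) : j a ⤳ j b :=
    hj.isInducing.specializes_iff.mpr ((PrimeSpectrum.le_iff_specializes _ _).mp h)
  obtain rfl | hlt := hcz'.eq_or_lt
  · exact .inl rfl
  refine .inr (Ideal.isMaximal_of_lt_of_forall_between k c'.asIdeal x.asIdeal hcx'
    (fun p hp h1 h2 ↦ ?_) z.asIdeal z.2 hlt)
  exact (H (j ⟨p, hp⟩) (spec h1) (spec h2)).imp
    (fun h ↦ congrArg PrimeSpectrum.asIdeal (hj.injective h))
    (fun h ↦ congrArg PrimeSpectrum.asIdeal (hj.injective h))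

end Affine

theorem exists_isOpenEmbedding_primeSpectrum {k : Type u} [Field k] {X : Scheme.{u}}
    (f : X ⟶ Spec (.of k)) [LocallyOfFiniteType f] (x : X) :
    ∃ (R : CommRingCat.{u}) (_ : Algebra k R) (j : PrimeSpectrum R → X),
      Algebra.FiniteType k R ∧ IsOpenEmbedding j ∧ x ∈ Set.range j := by
  obtain ⟨R, i, _, hx, -⟩ :=
    Scheme.exists_affine_mem_range_and_range_subset (U := ⊤) (x := x) trivial
  obtain ⟨φ, hφ⟩ := Spec.map_surjective (i ≫ f)
  have h : LocallyOfFiniteType (Spec.map φ) := by rw [hφ]; infer_instance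
  rw [HasRingHomProperty.Spec_iff (P := @LocallyOfFiniteType)] at h
  exact ⟨_, φ.hom.toAlgebra, i, h, i.isOpenEmbedding, hx⟩

theorem exists_isCurvePoint {k : Type u} [Field k] {X : Scheme.{u}}
    (f : X ⟶ Spec (.of k)) [LocallyOfFiniteType f] {U : Set X} (hU : IsOpen U)
    {v x : X} (hx : IsClosed {x}) (hxU : x ∉ U) (hv : v ∈ U) (hvx : v ⤳ x) :
    ∃ c ∈ U, v ⤳ c ∧ c ⤳ x ∧ IsCurvePoint c := by
  have : JacobsonSpace X := LocallyOfFiniteType.jacobsonSpace f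
  obtain ⟨R, _, j, _, hj, hxj⟩ := exists_isOpenEmbedding_primeSpectrum f x
  have : IsNoetherianRing R := Algebra.FiniteType.isNoetherianRing k R
  obtain ⟨c, hcU, hvc, hcx, H⟩ := exists_specializes_forall_between_of_affine hj hU hxj hv hvx
  have hc : ¬ IsClosed {c} := fun h ↦ hxU <| by
    rwa [(hcx.mem_closed h rfl : x = c)]
  refine ⟨c, hcU, hvc, hcx, hc, fun z hcz ↦ ?_⟩
  have haff (y : X) (hcy : c ⤳ y) (hyj : y ∈ Set.range j) :=
    eq_or_isClosed_singleton_of_forall_between k hj hx hcx H hxj hyj hcy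
  obtain ⟨S, _, i, _, hi, hzi⟩ := exists_isOpenEmbedding_primeSpectrum f z
  -- `z` may lie outside the chart of `x`. A closed point `w` of the curve in both charts replaces
  -- `x` in the chart of `z`.
  obtain ⟨w, ⟨hcw, hwi, hwj⟩, hw⟩ := nonempty_inter_closedPoints
    (Z := closure {c} ∩ (Set.range i ∩ Set.range j))
    ⟨c, subset_closure rfl, hcz.mem_open hi.isOpen_range hzi,
      hcx.mem_open hj.isOpen_range hxj⟩
    (isClosed_closure.isLocallyClosed.inter (hi.isOpen_range.inter hj.isOpen_range).isLocallyClosed)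
  refine eq_or_isClosed_singleton_of_forall_between k hi hw (specializes_iff_mem_closure.mpr hcw)
    (fun d hcd hdw ↦ ?_) hwi hzi hcz
  refine (haff d hcd (hdw.mem_open hj.isOpen_range hwj)).imp_right fun hd ↦ ?_
  exact (hdw.mem_closed hd rfl : w = d).symm

/-! ### Closed points and dimension one -/

section ClosedPoints

variable {X : Type*} [TopologicalSpace X]

/-- The closed points in the closure of a point. -/
def closedSpecializations (z : X) : Set (closedPoints X) := {x | z ⤳ x.1}

theorem isClosed_closedSpecializations (z : X) : IsClosed (closedSpecializations z) := by
  have h : closedSpecializations z = Subtype.val ⁻¹' closure {z} := by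
    ext; exact specializes_iff_mem_closure
  exact h ▸ isClosed_closure.preimage continuous_subtype_val

/-- In a Jacobson space closed points are dense in every closed set, so they detect specialization.
-/
theorem closedSpecializations_subset_iff [JacobsonSpace X] {a b : X} :
    closedSpecializations a ⊆ closedSpecializations b ↔ b ⤳ a := by
  refine ⟨fun h ↦ ?_, fun h x hx ↦ h.trans hx⟩
  rw [specializes_iff_mem_closure, ← Set.singleton_subset_iff,
    ← isClosed_closure.closure_subset_iff, ← closure_inter_closedPoints isClosed_closure, isClosed_closure.closure_subset_iff]
  exact fun x hx ↦ specializes_iff_mem_closure.mp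
    (h (show (⟨x, hx.2⟩ : closedPoints X) ∈ closedSpecializations a from
      specializes_iff_mem_closure.mpr hx.1))

theorem mem_closure_image_closedSpecializations [JacobsonSpace X] (z : X) :
    z ∈ closure (Subtype.val '' closedSpecializations z) := by
  have h : Subtype.val '' closedSpecializations z = closure {z} ∩ closedPoints X := by
    ext x
    simp [closedSpecializations, specializes_iff_mem_closure, and_comm]
  rw [h, closure_inter_closedPoints isClosed_closure]
  exact subset_closure rfl

theorem closedSpecializations_nonempty [JacobsonSpace X] (z : X) :
    (closedSpecializations z).Nonempty :=
  Set.image_nonempty.mp (closure_nonempty_iff.mp ⟨z, mem_closure_image_closedSpecializations z⟩)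

theorem isIrreducible_closedSpecializations [JacobsonSpace X] (z : X) :
    IsIrreducible (closedSpecializations z) := by
  refine ⟨closedSpecializations_nonempty z, fun U V hU hV ⟨x, hx, hxU⟩ ⟨y, hy, hyV⟩ ↦ ?_⟩
  obtain ⟨U, hU', rfl⟩ := isOpen_induced_iff.mp hU
  obtain ⟨V, hV', rfl⟩ := isOpen_induced_iff.mp hV
  obtain ⟨_, ⟨hwU, hwV⟩, w, hw, rfl⟩ :=
    mem_closure_iff.mp (mem_closure_image_closedSpecializations z) (U ∩ V) (hU'.inter hV') ⟨hx.mem_open hU' hxU, hy.mem_open hV' hyV⟩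
  exact ⟨w, hw, hwU, hwV⟩

theorem exists_eq_closedSpecializations [QuasiSober X] {D : Set (closedPoints X)}
    (hD : IsClosed D) (hD' : IsIrreducible D) : ∃ z, D = closedSpecializations z := by
  have hirr := (hD'.image Subtype.val continuous_subtype_val.continuousOn).closure
  obtain ⟨z, hz⟩ := QuasiSober.sober hirr isClosed_closure
  refine ⟨z, Set.ext fun x ↦ ?_⟩
  rw [closedSpecializations, Set.mem_ofPred, hz.specializes_iff_mem, ← closure_subtype,
    hD.closure_eq]

theorem closedSpecializations_eq_singleton {x : X} (hx : IsClosed {x}) :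
    closedSpecializations x = {⟨x, hx⟩} := by
  ext y
  refine ⟨fun h ↦ Subtype.ext (h.mem_closed hx rfl), fun h ↦ ?_⟩
  rw [Set.mem_singleton_iff.mp h]
  exact specializes_rfl

theorem exists_image_eq_closedSpecializations [QuasiSober X] [JacobsonSpace X] {c : X}
    (A : TopologicalSpace.IrreducibleCloseds (closedSpecializations c)) :
    ∃ z, c ⤳ z ∧ Subtype.val '' (A : Set (closedSpecializations c)) = closedSpecializations z := by
  obtain ⟨z, hz⟩ := exists_eq_closedSpecializations
    ((isClosed_closedSpecializations c).isClosedEmbedding_subtypeVal.isClosedMap _ A.isClosed)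
    (A.isIrreducible.image _ continuous_subtype_val.continuousOn)
  refine ⟨z, closedSpecializations_subset_iff.mp ?_, hz⟩
  rw [← hz]
  rintro _ ⟨x, -, rfl⟩
  exact x.2

theorem exists_image_eq_closedSpecializations_of_specializes [JacobsonSpace X] {c z : X}
    (h : c ⤳ z) : ∃ A : TopologicalSpace.IrreducibleCloseds (closedSpecializations c),
      Subtype.val '' (A : Set (closedSpecializations c)) = closedSpecializations z := by
  have himg : Subtype.val '' (Subtype.val ⁻¹' closedSpecializations z :
      Set (closedSpecializations c)) = closedSpecializations z := by
    rw [Subtype.image_preimage_coe, Set.inter_eq_right]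
    exact closedSpecializations_subset_iff.mpr h
  refine ⟨⟨Subtype.val ⁻¹' closedSpecializations z, ?_,
    (isClosed_closedSpecializations z).preimage continuous_subtype_val⟩, himg⟩
  have hirr := isIrreducible_closedSpecializations z
  refine ⟨Set.image_nonempty.mp (himg ▸ hirr.nonempty),
    fun U V hU hV ⟨a, ha, haU⟩ ⟨b, hb, hbV⟩ ↦ ?_⟩
  obtain ⟨U, hU', rfl⟩ := isOpen_induced_iff.mp hU
  obtain ⟨V, hV', rfl⟩ := isOpen_induced_iff.mp hV
  obtain ⟨w, hw, hwUV⟩ := hirr.isPreirreducible U V hU' hV' ⟨a, ha, haU⟩ ⟨b, hb, hbV⟩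
  exact ⟨⟨w, closedSpecializations_subset_iff.mpr h hw⟩, hw, hwUV⟩

theorem topologicalKrullDim_closedSpecializations_eq_one_iff [QuasiSober X] [T0Space X]
    [JacobsonSpace X] (c : X) :
    topologicalKrullDim (closedSpecializations c) = 1 ↔ IsCurvePoint c := by
  have le_iff {A B : TopologicalSpace.IrreducibleCloseds (closedSpecializations c)} {a b : X}
      (hA : Subtype.val '' (A : Set (closedSpecializations c)) = closedSpecializations a)
      (hB : Subtype.val '' (B : Set (closedSpecializations c)) = closedSpecializations b) :
      A ≤ B ↔ b ⤳ a := by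
    rw [← closedSpecializations_subset_iff, ← hA, ← hB,
      Set.image_subset_image_iff Subtype.val_injective]
    rfl
  obtain ⟨T, hT⟩ := exists_image_eq_closedSpecializations_of_specializes (specializes_refl c)
  refine ⟨fun h ↦ ⟨fun hc ↦ ?_, fun z hz ↦ ?_⟩, fun h ↦ le_antisymm ?_ ?_⟩
  · obtain ⟨A, B, hAB⟩ := Order.one_le_krullDim_iff.mp h.ge
    obtain ⟨a, ha, hA⟩ := exists_image_eq_closedSpecializations A
    obtain ⟨b, hb, hB⟩ := exists_image_eq_closedSpecializations B
    refine hAB.not_ge ((le_iff hB hA).mpr ?_)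
    rw [(ha.mem_closed hc rfl : a = c), (hb.mem_closed hc rfl : b = c)]
  · obtain ⟨A, hA⟩ := exists_image_eq_closedSpecializations_of_specializes hz
    -- Minimal sets come from closed points, the maximal one from `c`.
    obtain hmin | hmax := Order.krullDim_le_one_iff.mp h.le A
    · obtain ⟨w, hw⟩ := closedSpecializations_nonempty z
      obtain ⟨B, hB⟩ := exists_image_eq_closedSpecializations_of_specializes (hz.trans hw)
      have h1 := (le_iff hA hB).mp (hmin ((le_iff hB hA).mpr hw))
      exact .inr ((h1.antisymm hw).eq ▸ w.2)
    · exact .inl ((le_iff hT hA).mp (hmax ((le_iff hA hT).mpr hz)) |>.antisymm hz).eq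
  · refine Order.krullDim_le_one_iff.mpr fun A ↦ ?_
    obtain ⟨a, ha, hA⟩ := exists_image_eq_closedSpecializations A
    obtain rfl | ha' := h.2 a ha
    · refine .inr fun B _ ↦ ?_
      obtain ⟨b, hb, hB⟩ := exists_image_eq_closedSpecializations B
      exact (le_iff hB hA).mpr hb
    · refine .inl fun B hBA ↦ ?_
      obtain ⟨b, hb, hB⟩ := exists_image_eq_closedSpecializations B
      rw [le_iff hA hB, (((le_iff hB hA).mp hBA).mem_closed ha' rfl : b = a)]
  · obtain ⟨w, hw⟩ := closedSpecializations_nonempty c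
    obtain ⟨B, hB⟩ := exists_image_eq_closedSpecializations_of_specializes hw
    refine Order.one_le_krullDim_iff.mpr ⟨B, T, (le_iff hB hT).mpr hw, fun hle ↦ h.1 ?_⟩
    exact (((le_iff hT hB).mp hle).antisymm hw).eq ▸ w.2

end ClosedPoints

/-- A point in the closure of a locally closed set is a specialization of a point of that set. -/
theorem exists_specializes_of_mem_closure {X : Type*} [TopologicalSpace X]
    [TopologicalSpace.NoetherianSpace X] [QuasiSober X] {W : Set X} (hW : IsLocallyClosed W) {x : X}
    (hx : x ∈ closure W) : ∃ v ∈ W, v ⤳ x := by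
  obtain ⟨U, Z, hU, hZ, rfl⟩ := hW
  obtain ⟨S, hSf, hSc, hSi, hS⟩ :=
    TopologicalSpace.NoetherianSpace.exists_finite_set_isClosed_irreducible hZ
  have hsub : closure (U ∩ Z) ⊆ ⋃ t ∈ S, closure (U ∩ t) := by
    rw [hS, Set.sUnion_eq_biUnion, Set.inter_iUnion₂, hSf.closure_biUnion]
  obtain ⟨t, htS, hxt⟩ := Set.mem_iUnion₂.mp (hsub hx)
  obtain ⟨v, hv⟩ := QuasiSober.sober (hSi t htS) (hSc t htS)
  have hne : (t ∩ U).Nonempty := by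
    rw [Set.inter_comm]
    exact closure_nonempty_iff.mp ⟨x, hxt⟩
  refine ⟨v, ⟨(hv.mem_open_set_iff hU).mpr hne, ?_⟩, ?_⟩
  · rw [hS]; exact ⟨t, htS, hv.mem⟩
  · exact hv.specializes ((hSc t htS).closure_subset_iff.mpr Set.inter_subset_right hxt)

end AlgebraicGeometry

namespace AlgebraicPrevariety

variable {K : Type u} [Field K]

theorem isIrreducibleCurve_iff {X : AlgebraicPrevariety K} {C : Set X.Point} :
    IsIrreducibleCurve C ↔ ∃ c : X.scheme, IsCurvePoint c ∧ C = closedSpecializations c := by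
  have : JacobsonSpace X.scheme := LocallyOfFiniteType.jacobsonSpace X.str
  refine ⟨fun h ↦ ?_, fun ⟨c, hc, hC⟩ ↦ ?_⟩
  · obtain ⟨c, rfl⟩ := exists_eq_closedSpecializations h.isClosed h.isIrreducible
    exact ⟨c, (topologicalKrullDim_closedSpecializations_eq_one_iff c).mp h.dim_eq_one, rfl⟩
  · subst hC
    exact ⟨isClosed_closedSpecializations c, isIrreducible_closedSpecializations c,
      (topologicalKrullDim_closedSpecializations_eq_one_iff c).mpr hc⟩

end AlgebraicPrevariety

/-! ### Closures of images and constructible sets -/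

namespace AlgebraicGeometry

/-- A point in the closure of the image of a closed set is a specialization of a point of that
image. -/
theorem exists_specializes_of_mem_closure_image {X Y : Type*} [TopologicalSpace X]
    [TopologicalSpace Y] [TopologicalSpace.NoetherianSpace X] [QuasiSober X] {f : X → Y}
    (hf : Continuous f) {F : Set X} (hF : IsClosed F) {y : Y} (hy : y ∈ closure (f '' F)) :
    ∃ v ∈ F, f v ⤳ y := by
  obtain ⟨S, hSf, hSc, hSi, hS⟩ :=
    TopologicalSpace.NoetherianSpace.exists_finite_set_isClosed_irreducible hF
  rw [hS, Set.sUnion_eq_biUnion, Set.image_iUnion₂, hSf.closure_biUnion] at hy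
  obtain ⟨t, htS, hyt⟩ := Set.mem_iUnion₂.mp hy
  obtain ⟨v, hv⟩ := QuasiSober.sober (hSi t htS) (hSc t htS)
  refine ⟨v, hS ▸ ⟨t, htS, hv.mem⟩, specializes_iff_mem_closure.mpr ?_⟩
  exact (hv.image hf).def ▸ hyt

/-- A constructible set or its complement contains a neighbourhood of `v` in the closure of `v`. -/
theorem exists_isOpen_inter_subset_or_of_isConstructible {X : Type*} [TopologicalSpace X]
    {s : Set X} (hs : IsConstructible s) (v : X) :
    (∃ U, IsOpen U ∧ v ∈ U ∧ closure {v} ∩ U ⊆ s) ∨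
      ∃ U, IsOpen U ∧ v ∈ U ∧ closure {v} ∩ U ⊆ sᶜ := by
  induction hs using IsConstructible.empty_union_induction with
  | open_retrocompact U hU _ =>
    by_cases hv : v ∈ U
    · exact .inl ⟨U, hU, hv, Set.inter_subset_right⟩
    · refine .inr ⟨Set.univ, isOpen_univ, trivial, Set.inter_subset_left.trans ?_⟩
      exact hU.isClosed_compl.closure_subset_iff.mpr (Set.singleton_subset_iff.mpr hv)
  | union s hs t ht hs' ht' =>
    obtain ⟨U, hU, hvU, h⟩ | ⟨U, hU, hvU, h⟩ := hs'
    · exact .inl ⟨U, hU, hvU, h.trans Set.subset_union_left⟩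
    obtain ⟨V, hV, hvV, h'⟩ | ⟨V, hV, hvV, h'⟩ := ht'
    · exact .inl ⟨V, hV, hvV, h'.trans Set.subset_union_right⟩
    refine .inr ⟨U ∩ V, hU.inter hV, ⟨hvU, hvV⟩, fun x ⟨hx, hxU, hxV⟩ ↦ ?_⟩
    exact fun hxst ↦ hxst.elim (h ⟨hx, hxU⟩) (h' ⟨hx, hxV⟩)
  | compl s hs ih => simpa [or_comm] using ih

end AlgebraicGeometry

/-! ### The two implications -/

namespace AlgebraicPrevariety

variable {K : Type u} [Field K]

instance (X : AlgebraicPrevariety K) : JacobsonSpace X.scheme :=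
  LocallyOfFiniteType.jacobsonSpace X.str

instance (X : AlgebraicPrevariety K) : IsNoetherian X.scheme :=
  have := LocallyOfFiniteType.isLocallyNoetherian X.str
  have : CompactSpace X.scheme := QuasiCompact.compactSpace_of_compactSpace X.str
  { }

variable {X Y : AlgebraicPrevariety K} (p : X.Hom Y)

theorem Hom.locallyOfFiniteType_hom : LocallyOfFiniteType p.hom := by
  have h : LocallyOfFiniteType (p.hom ≫ Y.str) := by
    rw [p.w]; infer_instance
  exact locallyOfFiniteType_of_comp p.hom Y.str

theorem Hom.continuous_onPoints : Continuous p.onPoints :=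
  (p.hom.continuous.comp continuous_subtype_val).subtype_mk _

variable {p}

theorem Hom.CurveCoveringProperty.isSubmersive (hp : Function.Surjective p.onPoints)
    (h : p.CurveCoveringProperty) : p.IsSubmersive := by
  refine isQuotientMap_iff_isClosed.mpr ⟨hp, fun Z ↦
    ⟨fun hZ ↦ hZ.preimage p.continuous_onPoints, fun hZ ↦ ?_⟩⟩
  obtain ⟨F, hF, hFZ⟩ := isClosed_induced_iff.mp hZ
  have mem_Z {x : X.Point} : x.1 ∈ F ↔ p.onPoints x ∈ Z := Set.ext_iff.mp hFZ x
  have := p.locallyOfFiniteType_hom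
  have hcons : IsConstructible (p.hom '' F) := by
    refine p.hom.isConstructible_image (.of_compl ?_)
    exact (TopologicalSpace.NoetherianSpace.isCompact _).isConstructible hF.isOpen_compl
  have mem_Z' (y : Y.Point) (hy : y.1 ∈ p.hom '' F) : y ∈ Z := by
    obtain ⟨a, haF, ha⟩ := hy
    -- The fibre over the closed point `y` is closed, so its nonempty intersection with `F` contains
    -- a closed point of `X`.
    obtain ⟨b, ⟨hbF, hb⟩, hbX⟩ := nonempty_inter_closedPoints
      (Z := F ∩ p.hom ⁻¹' {y.1}) ⟨a, haF, ha⟩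
      (hF.inter (y.2.preimage p.hom.continuous)).isLocallyClosed
    have := mem_Z (x := ⟨b, hbX⟩).mp hbF
    rwa [show p.onPoints ⟨b, hbX⟩ = y from Subtype.ext hb] at this
  rw [← closure_subset_iff_isClosed]
  intro y hy
  by_contra hyZ
  have hyF : y.1 ∈ closure (p.hom '' F) := by
    refine closure_mono ?_ (closure_subtype.mp hy)
    rintro _ ⟨z, hz, rfl⟩
    obtain ⟨x, rfl⟩ := hp z
    exact ⟨x.1, mem_Z.mpr hz, rfl⟩
  obtain ⟨v, hvF, hvy⟩ := exists_specializes_of_mem_closure_image p.hom.continuous hF hyF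
  obtain ⟨U, hU, hvU, hUF⟩ := (exists_isOpen_inter_subset_or_of_isConstructible hcons
    (p.hom v)).resolve_right fun ⟨U, _, hvU, hUF⟩ ↦ hUF ⟨subset_closure rfl, hvU⟩ ⟨v, hvF, rfl⟩
  have hyU : y.1 ∉ U := fun hyU ↦
    hyZ (mem_Z' y (hUF ⟨specializes_iff_mem_closure.mp hvy, hyU⟩))
  obtain ⟨c, hcU, hvc, hcy, hc⟩ := exists_isCurvePoint Y.str hU y.2 hyU hvU hvy
  obtain ⟨X', hX', ⟨x, hx, rfl⟩, hsub, hdense⟩ :=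
    h _ (isIrreducibleCurve_iff.mpr ⟨c, hc, rfl⟩) y hcy
  obtain ⟨ξ, -, rfl⟩ := isIrreducibleCurve_iff.mp hX'
  have map_spec {x : X.scheme} (hx : ξ ⤳ x) : p.hom ξ ⤳ p.hom x := hx.map p.hom.continuous
  have hξc : p.hom ξ ⤳ c := by
    refine closedSpecializations_subset_iff.mp (hdense.trans ?_)
    refine (isClosed_closedSpecializations _).closure_subset_iff.mpr ?_
    rintro _ ⟨x, hx, rfl⟩
    exact map_spec hx
  have hspec (x : X.Point) (hx : ξ ⤳ x.1) (hxU : p.hom x.1 ∈ U) : x.1 ∈ F := by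
    refine mem_Z.mpr (mem_Z' _ (hUF ⟨specializes_iff_mem_closure.mp ?_, hxU⟩))
    exact hvc.trans (hsub ⟨x, hx, rfl⟩)
  -- Closed points of the lifted curve over `U` lie in `F`; they are dense in the curve because `ξ`
  -- itself lies over `U`.
  have hξF : ξ ∈ F := by
    have hcl := JacobsonSpace.closure_inter_closedPoints_eq_closure
      (S := closure {ξ} ∩ p.hom ⁻¹' U) (isClosed_closure.isLocallyClosed.inter
        (hU.preimage p.hom.continuous).isLocallyClosed)
    have hmem : ξ ∈ closure (closure {ξ} ∩ p.hom ⁻¹' U) :=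
      subset_closure ⟨subset_closure rfl, hξc.mem_open hU hcU⟩
    rw [← hcl] at hmem
    refine hF.closure_subset_iff.mpr ?_ hmem
    rintro x ⟨⟨hx, hxU⟩, hxc⟩
    exact hspec ⟨x, hxc⟩ (specializes_iff_mem_closure.mpr hx) hxU
  exact hyZ (mem_Z.mp (Specializes.mem_closed hx hF hξF))

theorem Hom.IsSubmersive.curveCoveringProperty (h : p.IsSubmersive) :
    p.CurveCoveringProperty := by
  intro Y' hY' y hy
  obtain ⟨c, hc, rfl⟩ := isIrreducibleCurve_iff.mp hY'
  let W : Set X.scheme := p.hom ⁻¹' closure {c} ∩ (p.hom ⁻¹' {y.1})ᶜ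
  have hU : IsOpen (p.hom ⁻¹' {y.1})ᶜ := (y.2.preimage p.hom.continuous).isOpen_compl
  have hG : IsClosed (p.hom ⁻¹' closure {c}) := isClosed_closure.preimage p.hom.continuous
  have hW : IsLocallyClosed W := hG.isLocallyClosed.inter hU.isLocallyClosed
  obtain ⟨x, ⟨hxW, hxy⟩, hx⟩ : (closure W ∩ p.hom ⁻¹' {y.1} ∩ closedPoints X.scheme).Nonempty := by
    refine nonempty_inter_closedPoints ?_
      (isClosed_closure.inter (y.2.preimage p.hom.continuous)).isLocallyClosed
    by_contra hempty
    have hWc : IsClosed W := by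
      rw [← closure_subset_iff_isClosed]
      refine fun x hx ↦ ⟨hG.closure_subset_iff.mpr Set.inter_subset_left hx, fun hxy ↦ ?_⟩
      exact hempty ⟨x, hx, hxy⟩
    have hYc : IsClosed (closedSpecializations c \ {y}) := by
      rw [(isQuotientMap_iff_isClosed.mp h).2]
      convert hWc.preimage (continuous_subtype_val (p := (· ∈ closedPoints X.scheme))) using 1
      ext x
      simp only [W, Set.mem_preimage, Set.mem_inter_iff, Set.mem_sdiff, Set.mem_compl_iff,
        Set.mem_singleton_iff, ← specializes_iff_mem_closure, Subtype.ext_iff]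
      rfl
    have hy1 : IsClosed ({y} : Set Y.Point) := by
      rw [← closedSpecializations_eq_singleton y.2]
      exact isClosed_closedSpecializations _
    obtain hl | hr := isPreirreducible_iff_isClosed_union_isClosed.mp
      (isIrreducible_closedSpecializations c).isPreirreducible _ _ hYc hy1
      fun z hz ↦ (em (z = y)).elim .inr fun hzy ↦ .inl ⟨hz, hzy⟩
    · exact (hl hy).2 rfl
    · rw [← closedSpecializations_eq_singleton y.2, closedSpecializations_subset_iff] at hr
      exact hc.1 ((hr.antisymm hy).eq ▸ y.2)
  obtain ⟨v, hvW, hvx⟩ := exists_specializes_of_mem_closure hW hxW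
  obtain ⟨d, hdU, hvd, hdx, hd⟩ := exists_isCurvePoint X.str hU hx (fun h ↦ h hxy) hvW.2 hvx
  have hcd : c ⤳ p.hom d :=
    specializes_iff_mem_closure.mpr (hvd.mem_closed hG hvW.1)
  have hdy : p.hom d ⤳ y.1 := Set.mem_singleton_iff.mp hxy ▸ hdx.map p.hom.continuous
  -- If `p(d)` were closed it would equal its specialization `y`, but `d` is off the fibre.
  have hdc : p.hom d = c := (hc.2 _ hcd).resolve_right fun hcl ↦
    hdU (hdy.mem_closed hcl rfl : y.1 = p.hom d).symm
  refine ⟨closedSpecializations d, isIrreducibleCurve_iff.mpr ⟨d, hd, rfl⟩,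
    ⟨⟨x, hx⟩, hdx, Subtype.ext hxy⟩, ?_, fun z hz ↦ ?_⟩
  · rintro _ ⟨z, hz, rfl⟩
    exact hdc ▸ (show d ⤳ z.1 from hz).map p.hom.continuous
  · rw [closure_subtype]
    have h1 := image_closure_subset_closure_image p.hom.continuous
      ⟨d, mem_closure_image_closedSpecializations d, rfl⟩
    have h2 := (show c ⤳ z.1 from hz).mem_closed isClosed_closure (hdc ▸ h1)
    rwa [Set.image_image] at h2 ⊢

end AlgebraicPrevariety

theorem lemma1p3 {K : Type u} [Field K] [IsAlgClosed K] (X Y : AlgebraicPrevariety K)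
    (p : X.Hom Y) (hp : Function.Surjective p.onPoints) :
    p.CurveCoveringProperty ↔ p.IsSubmersive :=
  ⟨fun h ↦ h.isSubmersive hp, fun h ↦ h.curveCoveringProperty⟩
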